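/- Let $n \ge 1$. Let $\mathrm{NDPF}_n$ be the monoid, under composition, of nondecreasing parking functions of size $n$, i.e. nondecreasing maps $f:\{1,\dots,n\}\to\{1,\dots,n\}$ with $f(i)\le i$ for all $i$, and let $\mathbb{C}[\mathrm{NDPF}_n]$ be its monoid algebra. Let $e_1,\dots,e_n$ be the canonical basis of $\mathbb{C}^n$. The monoid acts linearly on $\mathbb{C}^n$ by $e_i\cdot f = e_{f(i)}$ and diagonally on exterior powers, $(x_1\wedge\dots\wedge x_m)\cdot f = (x_1\cdot f)\wedge\dots\wedge(x_m\cdot f)$; this makes $\bigwedge^m\mathbb{C}^n$ a right $\mathbb{C}[\mathrm{NDPF}_n]$-module for the product $fg := g\circ f$ (equivalently, a left module for the product $fg := f\circ g$). All modules below are taken on this side. For a composition $I=(i_1,\dots,i_p)$ of $n$ let $\mathrm{Des}(I)=\{i_1+\dots+i_j : 1\le j\le p-1\}=\{s_1<\dots<s_k\}$, and let $$P_I := (e_1\wedge e_{s_1+1}\wedge\dots\wedge e_{s_k+1})\cdot\mathbb{C}[\mathrm{NDPF}_n]\subset \textstyle\bigwedge^{k+1}\mathbb{C}^n$$ be the cyclic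 submodule generated by $e_1\wedge e_{s_1+1}\wedge\dots\wedge e_{s_k+1}$. Theorem. For every composition $I$ of $n$, the module $P_I$ is an indecomposable projective $\mathbb{C}[\mathrm{NDPF}_n]$-module. Moreover, the modules $P_I$, where $I$ runs over all compositions of $n$, form a complete set of representatives of the indecomposable projective $\mathbb{C}[\mathrm{NDPF}_n]$-modules: $P_I\not\cong P_J$ for $I\ne J$, and every indecomposable projective $\mathbb{C}[\mathrm{NDPF}_n]$-module is isomorphic to some $P_I$. -/

import Mathlib

/-- The monoid of nondecreasing parking functions of size `n`: the nondecreasing maps `f` from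
`{1, …, n}` to itself with `f i ≤ i` for all `i`, under composition, `(f * g) i = f (g i)`.
The set `{1, …, n}` is modelled by `Fin n`, so that `i + 1` is represented by `⟨i, _⟩`. -/
def NDPF (n : ℕ) : Submonoid (Function.End (Fin n)) where
  carrier := {f | Monotone f ∧ ∀ i, f i ≤ i}
  mul_mem' {_ g} hf hg := ⟨hf.1.comp hg.1, fun i => (hf.2 (g i)).trans (hg.2 i)⟩
  one_mem' := ⟨monotone_id, fun i => le_refl i⟩

/-- The monoid algebra `ℂ[NDPF_n]`. With the product of `NDPF n` being composition, its left
modules are the right modules over the algebra whose product is the opposite one,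
`f g := g ∘ f`. -/
abbrev NDPFAlg (n : ℕ) : Type := MonoidAlgebra ℂ (NDPF n)

/-- The natural representation on `ℂ^n`: the linear action determined by `f • e_i = e_{f(i)}`. -/
noncomputable def naturalRep (n : ℕ) : Representation ℂ (NDPF n) (Fin n → ℂ) where
  toFun f := (Pi.basisFun ℂ (Fin n)).constr ℂ fun i => Pi.single (f.1 i) 1
  map_one' := (Pi.basisFun ℂ (Fin n)).ext fun i => by
    rw [Module.Basis.constr_basis, Pi.basisFun_apply]; rfl
  map_mul' f g := (Pi.basisFun ℂ (Fin n)).ext fun i => by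
    rw [Module.End.mul_apply, Module.Basis.constr_basis, Module.Basis.constr_basis,
      ← Pi.basisFun_apply ℂ (Fin n) (g.1 i), Module.Basis.constr_basis]
    rfl

/-- The diagonal representation on the exterior power `⋀^m ℂ^n`:
`f • (x_1 ∧ ⋯ ∧ x_m) = (f • x_1) ∧ ⋯ ∧ (f • x_m)`. -/
noncomputable def exteriorRep (n m : ℕ) : Representation ℂ (NDPF n) (⋀[ℂ]^m (Fin n → ℂ)) where
  toFun f := exteriorPower.map m (naturalRep n f)
  map_one' := by rw [map_one]; exact exteriorPower.map_id (R := ℂ) (M := Fin n → ℂ)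
  map_mul' f g := by
    rw [map_mul, Module.End.mul_eq_comp, Module.End.mul_eq_comp, exteriorPower.map_comp]

/-- The exterior power `⋀^m ℂ^n` as a module over `ℂ[NDPF_n]`: the linear extension of the
diagonal action. -/
def ExteriorModule (n m : ℕ) : Type := ⋀[ℂ]^m (Fin n → ℂ)

noncomputable instance (n m : ℕ) : AddCommGroup (ExteriorModule n m) :=
  inferInstanceAs (AddCommGroup (⋀[ℂ]^m (Fin n → ℂ)))

noncomputable instance (n m : ℕ) : Module (NDPFAlg n) (ExteriorModule n m) :=
  Module.compHom (⋀[ℂ]^m (Fin n → ℂ)) (exteriorRep n m).asAlgebraHom.toRingHom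

/-- The descent set of a composition `I = (i_1, …, i_p)` of `n`: the set of the partial sums
`i_1 + ⋯ + i_j` with `1 ≤ j ≤ p - 1`, a subset of `{1, …, n - 1}`. -/
def descents {n : ℕ} (I : Composition n) : Finset ℕ :=
  (Finset.Ico 1 I.length).image I.sizeUpTo

theorem lt_of_mem_descents {n : ℕ} (I : Composition n) {s : ℕ} (hs : s ∈ descents I) :
    s < n := by
  obtain ⟨j, hj, rfl⟩ := Finset.mem_image.1 hs
  have h := (Finset.mem_Ico.1 hj).2
  exact (I.sizeUpTo_strict_mono h).trans_le (I.sizeUpTo_le _)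

/-- The `j`-th element (`j = 0, …, k - 1`) of `Des(I) = {s_1 < ⋯ < s_k}`, as an element of `Fin n`.
The element `⟨s, _⟩` of `Fin n` stands for the element `s + 1` of `{1, …, n}`, so this is the
index of the basis vector `e_{s_{j+1} + 1}`. -/
def descentIndex {n : ℕ} (I : Composition n) (j : Fin (descents I).card) : Fin n :=
  ⟨(descents I).orderEmbOfFin rfl j,
    lt_of_mem_descents I ((descents I).orderEmbOfFin_mem rfl j)⟩

/-- The vector `e_1 ∧ e_{s_1 + 1} ∧ ⋯ ∧ e_{s_k + 1}` of `⋀^{k+1} ℂ^n`, where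
`Des(I) = {s_1 < ⋯ < s_k}`; the index `0 : Fin n` stands for `1`. -/
noncomputable def descentWedge {n : ℕ} [NeZero n] (I : Composition n) :
    ExteriorModule n ((descents I).card + 1) :=
  exteriorPower.ιMulti ℂ ((descents I).card + 1) fun j =>
    Pi.single ((Fin.cons 0 (descentIndex I) : Fin ((descents I).card + 1) → Fin n) j) (1 : ℂ)

/-- The cyclic `ℂ[NDPF_n]`-submodule `P_I` of `⋀^{k+1} ℂ^n` generated by
`e_1 ∧ e_{s_1 + 1} ∧ ⋯ ∧ e_{s_k + 1}`. -/
noncomputable def principalSubmodule {n : ℕ} [NeZero n] (I : Composition n) :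
    Submodule (NDPFAlg n) (ExteriorModule n ((descents I).card + 1)) :=
  Submodule.span (NDPFAlg n) {descentWedge I}

/-- A module is indecomposable if it is nonzero and is not the internal direct sum of two
nonzero submodules. -/
def IsIndecomposableModule (R M : Type*) [Ring R] [AddCommGroup M] [Module R M] : Prop :=
  Nontrivial M ∧ ∀ N K : Submodule R M, IsCompl N K → N = ⊥ ∨ K = ⊥

/-! For `S` containing `0`, `retract S` is an idempotent e_S. Let t enumerate `S` increasingly, and
let P be the cyclic module `wedgeSpan t`. Since parking functions only lower points, the coefficient
c of t's wedge satisfies c(ax) = χ(a)c(x) on P, with χ(a) the coefficient in a·t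
(`wedgeCoord_smul`), and e_S x = c(x)·t (`retract_smul`). So a submodule not contained in ker c is
all of P: P is local, hence indecomposable. An isomorphism between two such modules forces each e_S
to fix the other support, so the supports agree.

A map out of P may send t to any w with e_S w = w and e_{S∖b} w = 0 for all b ≠ 0 in S
(`exists_linearMap_wedgeSpan`). The algebra contains such a w with w·t = t
(`exists_smul_basisWedge_eq_self`); this splits a ↦ a·t, so P is projective.

An indecomposable projective M has a simple quotient. A minimal S with e_S nonzero on it gives a
surjection from P, along which the quotient map of M lifts to a surjection M → P; this splits, so M
≅ P. Compositions of n correspond to the sets S through their boundaries. -/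

namespace NDPF

/-! ### Idempotent retractions in the monoid. -/

theorem mul_apply {n : ℕ} (f g : NDPF n) (x : Fin n) : (f * g).1 x = f.1 (g.1 x) := rfl

variable {n : ℕ} [NeZero n]

/-- The retraction of `Fin n` sending `x` to the largest element of `S` below `x`
(and to `0` if there is none). -/
noncomputable def retract (S : Finset (Fin n)) : NDPF n :=
  ⟨fun x => (S.filter (· ≤ x)).sup id,
    fun _ _ h => Finset.sup_mono fun _ hs => by
      rw [Finset.mem_filter] at hs ⊢
      exact ⟨hs.1, hs.2.trans h⟩,
    fun _ => Finset.sup_le fun _ hs => (Finset.mem_filter.1 hs).2⟩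

theorem retract_apply_le (S : Finset (Fin n)) (x : Fin n) : (retract S).1 x ≤ x :=
  (retract S).2.2 x

theorem le_retract_apply {S : Finset (Fin n)} {s x : Fin n} (hs : s ∈ S) (h : s ≤ x) :
    s ≤ (retract S).1 x :=
  Finset.le_sup (f := id) (Finset.mem_filter.2 ⟨hs, h⟩)

theorem retract_apply_mem {S : Finset (Fin n)} (h0 : 0 ∈ S) (x : Fin n) :
    (retract S).1 x ∈ S := by
  obtain ⟨s, hs, h⟩ := Finset.exists_mem_eq_sup (S.filter (· ≤ x))
    ⟨0, Finset.mem_filter.2 ⟨h0, Fin.zero_le x⟩⟩ id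
  change (S.filter (· ≤ x)).sup id ∈ S
  rw [h]
  exact (Finset.mem_filter.1 hs).1

theorem retract_apply_of_mem {S : Finset (Fin n)} {s : Fin n} (hs : s ∈ S) :
    (retract S).1 s = s :=
  le_antisymm (retract_apply_le S s) (le_retract_apply hs le_rfl)

theorem retract_univ : retract (Finset.univ : Finset (Fin n)) = 1 :=
  Subtype.ext (funext fun x => retract_apply_of_mem (Finset.mem_univ x))

theorem retract_mul_retract_of_subset {S T : Finset (Fin n)} (h : T ⊆ S) :
    retract T * retract S = retract T := by
  refine Subtype.ext (funext fun x => ?_)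
  change (T.filter (· ≤ (retract S).1 x)).sup id = (T.filter (· ≤ x)).sup id
  congr 1
  refine Finset.filter_congr fun t ht => ?_
  exact ⟨fun hx => hx.trans (retract_apply_le S x), fun hx => le_retract_apply (h ht) hx⟩

theorem retract_mul_retract_of_superset {S T : Finset (Fin n)} (h0 : 0 ∈ T) (h : T ⊆ S) :
    retract S * retract T = retract T :=
  Subtype.ext (funext fun x => retract_apply_of_mem (h (retract_apply_mem h0 x)))

theorem retract_erase_apply_lt {S : Finset (Fin n)} {i : Fin n} (h0 : 0 ∈ S) (hi : i ≠ 0) :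
    (retract (S.erase i)).1 i < i :=
  lt_of_le_of_ne (retract_apply_le _ _)
    (Finset.ne_of_mem_erase (retract_apply_mem (Finset.mem_erase.2 ⟨hi.symm, h0⟩) i))

/-- After reduction to points of `S`, only `i` is moved by the rightmost factor, and it lands on a
smaller point of `S` fixed by both retractions. This relation lets the annihilators of
`exists_smul_basisWedge_eq_self` be imposed one at a time. -/
theorem retract_erase_mul_mul {S : Finset (Fin n)} {i j : Fin n} (h0 : 0 ∈ S) (hi : i ∈ S)
    (hi0 : i ≠ 0) (hij : i < j) :
    retract (S.erase i) * retract (S.erase j) * retract (S.erase i) =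
      retract (S.erase i) * retract (S.erase j) := by
  have hS : ∀ k x, (retract (S.erase k)).1 ((retract S).1 x) = (retract (S.erase k)).1 x :=
    fun k x => congr_fun
      (congr_arg Subtype.val (retract_mul_retract_of_subset (Finset.erase_subset k S))) x
  refine Subtype.ext (funext fun x => ?_)
  simp only [mul_apply]
  rw [← hS j x, ← hS i x]
  have hz := retract_apply_mem h0 x
  generalize (retract S).1 x = z at hz
  by_cases h : z = i
  · subst h
    have h1 := retract_erase_apply_lt h0 hi0
    have h2 : (retract (S.erase z)).1 z ∈ S.erase z :=
      retract_apply_mem (Finset.mem_erase.2 ⟨hi0.symm, h0⟩) z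
    rw [retract_apply_of_mem (Finset.mem_erase.2 ⟨hij.ne, hi⟩),
      retract_apply_of_mem (Finset.mem_erase.2
        ⟨(h1.trans hij).ne, Finset.mem_of_mem_erase h2⟩), retract_apply_of_mem h2]
  · rw [retract_apply_of_mem (S := S.erase i) (Finset.mem_erase.2 ⟨h, hz⟩)]

/-- A map which is not injective on `S` factors on `S` through the removal of an element. -/
theorem exists_mul_retract_erase {S : Finset (Fin n)} (h0 : 0 ∈ S) {f : NDPF n}
    (hf : ¬ Set.InjOn f.1 S) :
    ∃ b ∈ S, b ≠ 0 ∧ f * retract S = f * retract (S.erase b) := by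
  obtain ⟨s, hs, b, hb, hsb, hlt⟩ : ∃ s ∈ S, ∃ b ∈ S, f.1 s = f.1 b ∧ s < b := by
    simp only [Set.InjOn, not_forall] at hf
    obtain ⟨s, hs, b, hb, h, hne⟩ := hf
    rcases lt_or_gt_of_ne hne with h' | h'
    · exact ⟨s, hs, b, hb, h, h'⟩
    · exact ⟨b, hb, s, hs, h.symm, h'⟩
  have hb0 : b ≠ 0 := ((Fin.zero_le s).trans_lt hlt).ne'
  refine ⟨b, hb, hb0, ?_⟩
  rw [← retract_mul_retract_of_subset (Finset.erase_subset b S)]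
  refine Subtype.ext (funext fun x => ?_)
  simp only [mul_apply]
  have hz := retract_apply_mem h0 x
  generalize (retract S).1 x = z at hz
  by_cases h : z = b
  · subst h
    -- The retraction sends the removed point into [s, b], where monotone `f` is constant because
    -- f(s) = f(b).
    refine le_antisymm ?_ (f.2.1 (retract_apply_le _ _))
    rw [← hsb]
    exact f.2.1 (le_retract_apply (Finset.mem_erase.2 ⟨hlt.ne, hs⟩) hlt.le)
  · rw [retract_apply_of_mem (S := S.erase b) (Finset.mem_erase.2 ⟨h, hz⟩)]

end NDPF

open MonoidAlgebra (of)

/-! ### Basis wedges and their coefficient forms. -/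

section Wedge

variable {n m m' : ℕ}

noncomputable instance : Module ℂ (ExteriorModule n m) :=
  inferInstanceAs (Module ℂ (⋀[ℂ]^m (Fin n → ℂ)))

instance : IsScalarTower ℂ (NDPFAlg n) (ExteriorModule n m) where
  smul_assoc c a x := by
    exact congr_arg (fun φ : Module.End ℂ (⋀[ℂ]^m (Fin n → ℂ)) => φ x)
      (map_smul (exteriorRep n m).asAlgebraHom c a)

/-- The wedge product `e_{u 0} ∧ e_{u 1} ∧ ⋯` of vectors of the canonical basis. -/
noncomputable def basisWedge (u : Fin m → Fin n) : ExteriorModule n m :=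
  exteriorPower.ιMulti ℂ m fun j => Pi.single (u j) (1 : ℂ)

theorem of_smul_basisWedge (f : NDPF n) (u : Fin m → Fin n) :
    of ℂ (NDPF n) f • basisWedge u = basisWedge (f.1 ∘ u) := by
  change (exteriorRep n m).asAlgebraHom (of ℂ (NDPF n) f) (exteriorPower.ιMulti ℂ m _) =
    exteriorPower.ιMulti ℂ m _
  rw [Representation.asAlgebraHom_of]
  change exteriorPower.map m (naturalRep n f) _ = _
  rw [exteriorPower.map_apply_ιMulti]
  congr 1
  funext j
  simp only [Function.comp_apply]
  change (Pi.basisFun ℂ (Fin n)).constr ℂ _ _ = _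
  rw [← Pi.basisFun_apply ℂ (Fin n) (u j), Module.Basis.constr_basis]
  rfl

theorem basisWedge_eq_zero {u : Fin m → Fin n} (hu : ¬ Function.Injective u) :
    basisWedge u = 0 :=
  AlternatingMap.map_eq_zero_of_not_injective
    (exteriorPower.ιMulti ℂ m (M := Fin n → ℂ)) _ fun h => hu fun i j hij => h (by simp only [hij])

/-- The linear form giving the coefficient of `basisWedge t`. -/
noncomputable def wedgeCoord (t : Fin m → Fin n) : ExteriorModule n m →ₗ[ℂ] ℂ :=
  exteriorPower.pairingDual ℂ (Fin n → ℂ) m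
    (exteriorPower.ιMulti ℂ m ((Pi.basisFun ℂ (Fin n)).coord ∘ t))

theorem wedgeCoord_basisWedge_self {t : Fin m → Fin n} (ht : StrictMono t) :
    wedgeCoord t (basisWedge t) = 1 :=
  exteriorPower.pairingDual_apply_apply_eq_one (fun i => Pi.single i (1 : ℂ))
    (Pi.basisFun ℂ (Fin n)).coord (by simp)
    (fun i j h => by simp [h]) m (OrderEmbedding.ofStrictMono t ht)

theorem wedgeCoord_basisWedge_of_ne {t u : Fin m → Fin n} (ht : StrictMono t)
    (hu : StrictMono u) (h : t ≠ u) : wedgeCoord t (basisWedge u) = 0 :=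
  exteriorPower.pairingDual_apply_apply_eq_one_zero (fun i => Pi.single i (1 : ℂ))
    (Pi.basisFun ℂ (Fin n)).coord (fun i j h => by simp [h]) m
    (OrderEmbedding.ofStrictMono t ht) (OrderEmbedding.ofStrictMono u hu)
    fun h' => h (congr_arg DFunLike.coe h')

theorem NDPF.strictMono_comp {f : NDPF n} {t : Fin m → Fin n} (ht : StrictMono t)
    (h : Function.Injective (f.1 ∘ t)) : StrictMono (f.1 ∘ t) :=
  (f.2.1.comp ht.monotone).strictMono_of_injective h

open Classical in
theorem wedgeCoord_of_smul_basisWedge {t : Fin m → Fin n} (ht : StrictMono t) (f : NDPF n) :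
    wedgeCoord t (of ℂ (NDPF n) f • basisWedge t) = if f.1 ∘ t = t then 1 else 0 := by
  rw [of_smul_basisWedge]
  split_ifs with h
  · rw [h, wedgeCoord_basisWedge_self ht]
  · by_cases hi : Function.Injective (f.1 ∘ t)
    · exact wedgeCoord_basisWedge_of_ne ht (NDPF.strictMono_comp ht hi) (Ne.symm h)
    · rw [basisWedge_eq_zero hi, map_zero]

/-- The cyclic submodule generated by `basisWedge t`. -/
noncomputable abbrev wedgeSpan (t : Fin m → Fin n) :
    Submodule (NDPFAlg n) (ExteriorModule n m) :=
  Submodule.span (NDPFAlg n) {basisWedge t}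

theorem basisWedge_mem (t : Fin m → Fin n) : basisWedge t ∈ wedgeSpan t :=
  Submodule.mem_span_singleton_self _

/-- On monoid elements the coefficient is 1 or 0 according to whether t is fixed, and a product of
order-lowering maps fixes t only if both factors do. -/
theorem wedgeCoord_smul {t : Fin m → Fin n} (ht : StrictMono t) (a : NDPFAlg n)
    {x : ExteriorModule n m} (hx : x ∈ wedgeSpan t) :
    wedgeCoord t (a • x) = wedgeCoord t (a • basisWedge t) * wedgeCoord t x := by
  obtain ⟨b, rfl⟩ := Submodule.mem_span_singleton.1 hx
  induction a using MonoidAlgebra.induction_on with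
  | add a a' h h' => simp only [add_smul, map_add, h, h', add_mul]
  | smul r a h => simp only [smul_assoc, map_smul, h, smul_eq_mul, mul_assoc]
  | of f =>
    induction b using MonoidAlgebra.induction_on with
    | add a a' h h' =>
      simp only [add_smul, smul_add, map_add,
        h (Submodule.smul_mem _ _ (basisWedge_mem t)),
        h' (Submodule.smul_mem _ _ (basisWedge_mem t)), mul_add]
    | smul r a h =>
      rw [smul_assoc, smul_comm, (wedgeCoord t).map_smul r, (wedgeCoord t).map_smul r,
        h (Submodule.smul_mem _ _ (basisWedge_mem t))]
      simp only [smul_eq_mul]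
      ring
    | of g =>
      classical
      rw [smul_smul, ← map_mul, wedgeCoord_of_smul_basisWedge ht,
        wedgeCoord_of_smul_basisWedge ht, wedgeCoord_of_smul_basisWedge ht]
      have key : (f * g).1 ∘ t = t ↔ f.1 ∘ t = t ∧ g.1 ∘ t = t := by
        constructor
        · intro h
          have hg : g.1 ∘ t = t := funext fun j =>
            le_antisymm (g.2.2 _) ((congr_fun h j).ge.trans (f.2.2 _))
          refine ⟨?_, hg⟩
          conv_lhs => rw [← hg]
          exact h
        · rintro ⟨hf, hg⟩
          conv_rhs => rw [← hf, ← hg]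
          rfl
      by_cases h1 : f.1 ∘ t = t <;> by_cases h2 : g.1 ∘ t = t <;>
        simp only [key, h1, h2, and_self, and_true, and_false, if_true, if_false, mul_one, mul_zero]

theorem StrictMono.eq_of_image_subset {t u : Fin m → Fin n} (ht : StrictMono t)
    (hu : StrictMono u) (h : ∀ j, u j ∈ Finset.univ.image t) : u = t := by
  have hc : ∀ v : Fin m → Fin n, StrictMono v → (Finset.univ.image v).card = m := fun v hv => by
    rw [Finset.card_image_of_injective _ hv.injective, Finset.card_univ, Fintype.card_fin]
  rw [Finset.orderEmbOfFin_unique (hc t ht) h hu]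
  exact (Finset.orderEmbOfFin_unique (hc t ht)
    (fun j => Finset.mem_image_of_mem t (Finset.mem_univ j)) ht).symm

theorem wedgeCoord_generator {t : Fin m → Fin n} (ht : StrictMono t) :
    wedgeCoord t (⟨basisWedge t, basisWedge_mem t⟩ : wedgeSpan t) ≠ 0 := by
  rw [wedgeCoord_basisWedge_self ht]
  exact one_ne_zero

/-! ### Locality and non-isomorphism. -/

variable [NeZero n]

theorem retract_comp_self (t : Fin m → Fin n) :
    (NDPF.retract (Finset.univ.image t)).1 ∘ t = t :=
  funext fun j => NDPF.retract_apply_of_mem (Finset.mem_image_of_mem t (Finset.mem_univ j))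

/-- The idempotent attached to the support of `basisWedge t` projects `wedgeSpan t` onto the line
spanned by its generator. -/
theorem retract_smul {t : Fin m → Fin n} (ht : StrictMono t) (h0 : 0 ∈ Finset.univ.image t)
    {x : ExteriorModule n m} (hx : x ∈ wedgeSpan t) :
    of ℂ (NDPF n) (NDPF.retract (Finset.univ.image t)) • x =
      wedgeCoord t x • basisWedge t := by
  obtain ⟨b, rfl⟩ := Submodule.mem_span_singleton.1 hx
  clear hx
  induction b using MonoidAlgebra.induction_on with
  | add a a' h h' => simp only [add_smul, smul_add, map_add, h, h']
  | smul r a h => rw [smul_assoc, smul_comm, map_smul, h, smul_assoc]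
  | of g =>
    classical
    rw [smul_smul, ← map_mul, wedgeCoord_of_smul_basisWedge ht, of_smul_basisWedge]
    split_ifs with hg
    · rw [one_smul]
      congr 1
      exact (congr_arg _ hg).trans (retract_comp_self t)
    · rw [zero_smul]
      -- If the wedge survived, the composite would map t increasingly into its own support, hence
      -- fix it; then t ≤ g ∘ t ≤ t.
      refine basisWedge_eq_zero fun hi => hg ?_
      have h := ht.eq_of_image_subset (NDPF.strictMono_comp ht hi)
        fun j => NDPF.retract_apply_mem h0 _
      refine funext fun j => le_antisymm (g.2.2 _) ?_
      conv_lhs => rw [← h]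
      exact NDPF.retract_apply_le (Finset.univ.image t) (g.1 (t j))

theorem eq_top_of_wedgeCoord_ne_zero {t : Fin m → Fin n} (ht : StrictMono t)
    (h0 : 0 ∈ Finset.univ.image t) {N : Submodule (NDPFAlg n) (wedgeSpan t)} {x : wedgeSpan t}
    (hx : x ∈ N) (hc : wedgeCoord t x ≠ 0) : N = ⊤ := by
  have he : (⟨basisWedge t, basisWedge_mem t⟩ : wedgeSpan t) ∈ N := by
    have := N.smul_mem (((wedgeCoord t x)⁻¹ : ℂ) •
      of ℂ (NDPF n) (NDPF.retract (Finset.univ.image t))) hx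
    convert! this
    rw [Submodule.coe_smul, smul_assoc, retract_smul ht h0 x.2, inv_smul_smul₀ hc]
  refine eq_top_iff.2 fun y _ => ?_
  obtain ⟨b, hb⟩ := Submodule.mem_span_singleton.1 y.2
  convert! N.smul_mem b he
  exact Subtype.ext hb.symm

theorem wedgeSpan_indecomposable {t : Fin m → Fin n} (ht : StrictMono t)
    (h0 : 0 ∈ Finset.univ.image t) : IsIndecomposableModule (NDPFAlg n) (wedgeSpan t) := by
  refine ⟨⟨⟨⟨basisWedge t, basisWedge_mem t⟩, 0, fun h => wedgeCoord_generator ht ?_⟩⟩,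
    fun N K hNK => ?_⟩
  · rw [h, ZeroMemClass.coe_zero, map_zero]
  · obtain ⟨y, hy, z, hz, hyz⟩ := Submodule.mem_sup.1
      (hNK.sup_eq_top.ge (Submodule.mem_top (x := ⟨basisWedge t, basisWedge_mem t⟩)))
    by_cases h : wedgeCoord t y = 0
    · have hK : K = ⊤ := eq_top_of_wedgeCoord_ne_zero ht h0 hz fun h' =>
        wedgeCoord_generator ht (by rw [← hyz, Submodule.coe_add, map_add, h, h', add_zero])
      subst hK
      exact Or.inl (disjoint_top.1 hNK.disjoint)
    · have hN := eq_top_of_wedgeCoord_ne_zero ht h0 hy h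
      subst hN
      exact Or.inr (top_disjoint.1 hNK.disjoint)

/-- The image of the generator has nonzero coefficient at u, since it generates. It is fixed by the
retraction onto t's support, which must therefore fix u. -/
theorem image_subset_of_linearEquiv {t : Fin m → Fin n} {u : Fin m' → Fin n}
    (hu : StrictMono u) (h0 : 0 ∈ Finset.univ.image t)
    (φ : wedgeSpan t ≃ₗ[NDPFAlg n] wedgeSpan u) :
    Finset.univ.image u ⊆ Finset.univ.image t := by
  set e : wedgeSpan t := ⟨basisWedge t, basisWedge_mem t⟩
  have hgen : wedgeCoord u (φ e) ≠ 0 := fun h => by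
    obtain ⟨y, hy⟩ := φ.surjective ⟨basisWedge u, basisWedge_mem u⟩
    obtain ⟨b, hb⟩ := Submodule.mem_span_singleton.1 y.2
    have hy' : y = b • e := Subtype.ext hb.symm
    refine wedgeCoord_generator hu ?_
    rw [← hy, hy', map_smul, Submodule.coe_smul, wedgeCoord_smul hu _ (φ e).2, h, mul_zero]
  have hfix : of ℂ (NDPF n) (NDPF.retract (Finset.univ.image t)) • e = e :=
    Subtype.ext (by
      rw [Submodule.coe_smul, of_smul_basisWedge, retract_comp_self])
  have hc := congr_arg (fun x => wedgeCoord u (φ x)) hfix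
  classical
  simp only [map_smul, Submodule.coe_smul] at hc
  rw [wedgeCoord_smul hu _ (φ e).2, wedgeCoord_of_smul_basisWedge hu] at hc
  split_ifs at hc with h
  · intro s hs
    obtain ⟨j, -, rfl⟩ := Finset.mem_image.1 hs
    rw [← congr_fun h j]
    exact NDPF.retract_apply_mem h0 _
  · exact absurd (by rw [← hc, zero_mul]) hgen

/-! ### Universal property of the cyclic modules. -/

section Lift

variable {M : Type*} [AddCommGroup M] [Module (NDPFAlg n) M]

theorem of_smul_eq_zero {S : Finset (Fin n)} (h0 : 0 ∈ S) {w : M}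
    (hw : of ℂ (NDPF n) (NDPF.retract S) • w = w)
    (hS : ∀ b ∈ S, b ≠ 0 → of ℂ (NDPF n) (NDPF.retract (S.erase b)) • w = 0)
    {f : NDPF n} (hf : ¬ Set.InjOn f.1 S) : of ℂ (NDPF n) f • w = 0 := by
  obtain ⟨b, hb, hb0, h⟩ := NDPF.exists_mul_retract_erase h0 hf
  rw [← hw, smul_smul, ← map_mul, h, map_mul, mul_smul, hS b hb hb0, smul_zero]

theorem smul_eq_zero_of_smul_basisWedge_eq_zero [Module ℂ M] [IsScalarTower ℂ (NDPFAlg n) M]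
    {t : Fin m → Fin n} (ht : StrictMono t) (h0 : 0 ∈ Finset.univ.image t) {w : M}
    (hw : of ℂ (NDPF n) (NDPF.retract (Finset.univ.image t)) • w = w)
    (hS : ∀ b ∈ Finset.univ.image t, b ≠ 0 →
      of ℂ (NDPF n) (NDPF.retract ((Finset.univ.image t).erase b)) • w = 0)
    {a : NDPFAlg n} (ha : a • basisWedge t = 0) : a • w = 0 := by
  classical
  -- `F u` is f • w for any f carrying t to u; by `hcongr` the choice of f is immaterial. The
  -- default 0 never meets a nonzero coefficient.
  let F : (Fin m ↪o Fin n) → M := fun u =>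
    if h : ∃ f : NDPF n, f.1 ∘ t = u then of ℂ (NDPF n) h.choose • w else 0
  have hcongr : ∀ f g : NDPF n, f.1 ∘ t = g.1 ∘ t →
      of ℂ (NDPF n) f • w = of ℂ (NDPF n) g • w := fun f g h => by
    rw [← hw, smul_smul, smul_smul, ← map_mul, ← map_mul]
    congr 2
    refine Subtype.ext (funext fun x => ?_)
    obtain ⟨j, -, hj⟩ := Finset.mem_image.1 (NDPF.retract_apply_mem h0 x)
    rw [NDPF.mul_apply, NDPF.mul_apply, ← hj]
    exact congr_fun h j
  have key : ∀ a : NDPFAlg n,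
      a • w = ∑ u : Fin m ↪o Fin n, wedgeCoord u (a • basisWedge t) • F u := fun a => by
    induction a using MonoidAlgebra.induction_on with
    | add a a' h h' => simp only [add_smul, map_add, h, h', Finset.sum_add_distrib]
    | smul r a h => simp only [smul_assoc, map_smul, h, Finset.smul_sum]
    | of f =>
      rw [of_smul_basisWedge]
      by_cases hf : Function.Injective (f.1 ∘ t)
      · have hm := NDPF.strictMono_comp ht hf
        rw [Finset.sum_eq_single (OrderEmbedding.ofStrictMono _ hm)]
        · have hex : ∃ g : NDPF n, g.1 ∘ t = OrderEmbedding.ofStrictMono _ hm := ⟨f, rfl⟩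
          have hF : F (OrderEmbedding.ofStrictMono _ hm) = of ℂ (NDPF n) hex.choose • w :=
            dif_pos hex
          rw [hF, hcongr _ f hex.choose_spec]
          change _ = wedgeCoord (f.1 ∘ t) (basisWedge (f.1 ∘ t)) • _
          rw [wedgeCoord_basisWedge_self hm, one_smul]
        · intro u _ hu
          rw [wedgeCoord_basisWedge_of_ne u.strictMono hm fun h => hu (DFunLike.coe_injective h),
            zero_smul]
        · exact fun h => absurd (Finset.mem_univ _) h
      · rw [basisWedge_eq_zero hf]
        simp only [map_zero, zero_smul, Finset.sum_const_zero]
        refine of_smul_eq_zero h0 hw hS fun hi => hf fun i j hij => ht.injective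
          (hi ?_ ?_ hij) <;> simp
  rw [key, ha]
  simp only [map_zero, zero_smul, Finset.sum_const_zero]

/-- The universal property of `wedgeSpan t`. -/
theorem exists_linearMap_wedgeSpan
    {t : Fin m → Fin n} (ht : StrictMono t) (h0 : 0 ∈ Finset.univ.image t) {w : M}
    (hw : of ℂ (NDPF n) (NDPF.retract (Finset.univ.image t)) • w = w)
    (hS : ∀ b ∈ Finset.univ.image t, b ≠ 0 →
      of ℂ (NDPF n) (NDPF.retract ((Finset.univ.image t).erase b)) • w = 0) :
    ∃ ψ : wedgeSpan t →ₗ[NDPFAlg n] M, ψ ⟨basisWedge t, basisWedge_mem t⟩ = w := by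
  let : Module ℂ M := Module.compHom M (algebraMap ℂ (NDPFAlg n))
  have : IsScalarTower ℂ (NDPFAlg n) M := IsScalarTower.of_algebraMap_smul fun _ _ => rfl
  set e : wedgeSpan t := ⟨basisWedge t, basisWedge_mem t⟩
  let p := LinearMap.toSpanSingleton (NDPFAlg n) (wedgeSpan t) e
  have hp : Function.Surjective p := fun y => by
    obtain ⟨b, hb⟩ := Submodule.mem_span_singleton.1 y.2
    exact ⟨b, Subtype.ext hb⟩
  have hker : LinearMap.ker p ≤ LinearMap.ker (LinearMap.toSpanSingleton (NDPFAlg n) M w) :=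
    fun a ha => smul_eq_zero_of_smul_basisWedge_eq_zero ht h0 hw hS
      (congr_arg Subtype.val (LinearMap.mem_ker.1 ha))
  refine ⟨(Submodule.liftQ _ _ hker).comp (p.quotKerEquivOfSurjective hp).symm.toLinearMap, ?_⟩
  have h1 : (p.quotKerEquivOfSurjective hp).symm e = Submodule.Quotient.mk 1 := by
    rw [LinearEquiv.symm_apply_eq]
    exact (one_smul (NDPFAlg n) e).symm
  rw [LinearMap.comp_apply, LinearEquiv.coe_coe, h1]
  exact one_smul _ w

end Lift

/-! ### Projectivity. -/

theorem exists_smul_basisWedge_eq_self {t : Fin m → Fin n} (ht : StrictMono t)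
    (h0 : 0 ∈ Finset.univ.image t) {B : Finset (Fin n)} (hB : B ⊆ Finset.univ.image t)
    (hB0 : 0 ∉ B) :
    ∃ x : NDPFAlg n, of ℂ (NDPF n) (NDPF.retract (Finset.univ.image t)) * x = x ∧
      (∀ b ∈ B, of ℂ (NDPF n) (NDPF.retract ((Finset.univ.image t).erase b)) * x = 0) ∧
      x • basisWedge t = basisWedge t := by
  set S := Finset.univ.image t
  induction B using Finset.induction_on_max with
  | empty =>
    refine ⟨of ℂ (NDPF n) (NDPF.retract S), ?_, by simp, ?_⟩
    · rw [← map_mul, NDPF.retract_mul_retract_of_subset subset_rfl]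
    · rw [of_smul_basisWedge, retract_comp_self]
  | insert a B ha ih =>
    obtain ⟨x, hx, hxB, hxt⟩ := ih (fun h => hB0 (Finset.mem_insert_of_mem h))
      fun b hb => hB (Finset.mem_insert_of_mem hb)
    have haS := hB (Finset.mem_insert_self a B)
    have ha0 : a ≠ 0 := fun h => hB0 (h ▸ Finset.mem_insert_self a B)
    have h0a : 0 ∈ S.erase a := Finset.mem_erase.2 ⟨ha0.symm, h0⟩
    -- Left multiplication by 1 - e_{S∖a}; as `a` exceeds all of `B`, the earlier annihilations
    -- persist by `NDPF.retract_erase_mul_mul`.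
    refine ⟨x - of ℂ (NDPF n) (NDPF.retract (S.erase a)) * x, ?_, fun b hb => ?_, ?_⟩
    · rw [mul_sub, hx, ← mul_assoc, ← map_mul,
        NDPF.retract_mul_retract_of_superset h0a (Finset.erase_subset a S)]
    · rcases Finset.mem_insert.1 hb with rfl | hb'
      · rw [mul_sub, ← mul_assoc, ← map_mul,
          NDPF.retract_mul_retract_of_subset subset_rfl, sub_self]
      · rw [mul_sub, hxB b hb', ← mul_assoc, ← map_mul,
          ← NDPF.retract_erase_mul_mul h0 (hB hb) (fun h => hB0 (h ▸ hb)) (ha b hb'), map_mul,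
          mul_assoc, hxB b hb', mul_zero, sub_zero]
    · rw [sub_smul, mul_smul, hxt, of_smul_basisWedge]
      refine (congr_arg _ (basisWedge_eq_zero fun hi => ?_)).trans (sub_zero _)
      have h := ht.eq_of_image_subset (NDPF.strictMono_comp ht hi)
        fun j => Finset.mem_of_mem_erase (NDPF.retract_apply_mem h0a _)
      obtain ⟨j, -, hj⟩ := Finset.mem_image.1 haS
      have h1 := NDPF.retract_erase_apply_lt h0 ha0
      have h2 : (NDPF.retract (S.erase a)).1 (t j) = t j := congr_fun h j
      rw [hj] at h2
      exact h1.ne h2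

theorem wedgeSpan_projective {t : Fin m → Fin n} (ht : StrictMono t)
    (h0 : 0 ∈ Finset.univ.image t) : Module.Projective (NDPFAlg n) (wedgeSpan t) := by
  obtain ⟨x, hx, hxB, hxt⟩ := exists_smul_basisWedge_eq_self ht h0
    (Finset.erase_subset 0 _) (Finset.notMem_erase 0 _)
  obtain ⟨ψ, hψ⟩ := exists_linearMap_wedgeSpan ht h0 hx
    fun b hb hb0 => hxB b (Finset.mem_erase.2 ⟨hb0, hb⟩)
  refine Module.Projective.of_split ψ (LinearMap.toSpanSingleton (NDPFAlg n) (wedgeSpan t)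
    ⟨basisWedge t, basisWedge_mem t⟩) (LinearMap.ext fun y => ?_)
  obtain ⟨b, hb⟩ := Submodule.mem_span_singleton.1 y.2
  have hy : y = b • (⟨basisWedge t, basisWedge_mem t⟩ : wedgeSpan t) := Subtype.ext hb.symm
  rw [hy, map_smul, LinearMap.comp_apply, hψ, LinearMap.id_apply]
  congr 1
  exact Subtype.ext hxt

end Wedge

/-! ### Simple quotients and split surjections. -/

/-- A nonzero module over a semiprimary ring has a maximal submodule. -/
theorem IsSemiprimaryRing.exists_isCoatom (R : Type*) [Ring R] [IsSemiprimaryRing R]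
    (M : Type*) [AddCommGroup M] [Module R M] :
    Nontrivial M → ∃ N : Submodule R M, IsCoatom N := by
  refine IsSemiprimaryRing.induction R R M
    (P := fun M _ _ _ => Nontrivial M → ∃ N : Submodule R M, IsCoatom N) ?_ ?_
  · intro M _ _ _ _ _ _ _
    exact (eq_top_or_exists_le_coatom (⊥ : Submodule R M)).elim
      (fun h => absurd h bot_ne_top) fun ⟨N, hN, _⟩ => ⟨N, hN⟩
  · intro M _ _ _ _ N hN hq hM
    by_cases h : N = ⊤
    · have e := (LinearEquiv.ofTop N h).symm
      obtain ⟨K, hK⟩ := hN e.symm.toEquiv.nontrivial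
      exact ⟨K.comap e.toLinearMap, (Submodule.isCoatom_comap_iff e.surjective).2 hK⟩
    · obtain ⟨K, hK⟩ := hq (Submodule.Quotient.nontrivial_iff.2 h)
      exact ⟨K.comap N.mkQ, (Submodule.isCoatom_comap_iff N.mkQ_surjective).2 hK⟩

theorem IsIndecomposableModule.bijective_of_surjective {R M P : Type*} [Ring R] [AddCommGroup M]
    [Module R M] [AddCommGroup P] [Module R P] [Nontrivial P] [Module.Projective R P]
    (hM : IsIndecomposableModule R M) {θ : M →ₗ[R] P} (hθ : Function.Surjective θ) :
    Function.Bijective θ := by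
  obtain ⟨σ, hσ⟩ := Module.projective_lifting_property θ LinearMap.id hθ
  have hσ' : ∀ p, θ (σ p) = p := fun p => LinearMap.congr_fun hσ p
  have hc : IsCompl (LinearMap.ker θ) (LinearMap.range σ) := by
    refine ⟨Submodule.disjoint_def.2 ?_, codisjoint_iff_le_sup.2 fun m _ => ?_⟩
    · rintro _ h ⟨p, rfl⟩
      rw [LinearMap.mem_ker, hσ'] at h
      rw [h, map_zero]
    · refine Submodule.mem_sup.2 ⟨m - σ (θ m), ?_, σ (θ m), ⟨_, rfl⟩, sub_add_cancel _ _⟩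
      rw [LinearMap.mem_ker, map_sub, hσ', sub_self]
  rcases hM.2 _ _ hc with h | h
  · exact ⟨LinearMap.ker_eq_bot.1 h, hθ⟩
  · obtain ⟨p, hp⟩ := exists_ne (0 : P)
    refine absurd ?_ hp
    rw [← hσ' p, LinearMap.range_eq_bot.1 h, LinearMap.zero_apply, map_zero]

instance NDPF.finite (n : ℕ) : Finite (NDPF n) :=
  Finite.of_injective (β := Fin n → Fin n) (fun f => f.1) Subtype.val_injective

instance NDPFAlg.isArtinianRing (n : ℕ) : IsArtinianRing (NDPFAlg n) :=
  haveI : Module.Finite ℂ (NDPFAlg n) := inferInstanceAs (Module.Finite ℂ (MonoidAlgebra ℂ (NDPF n)))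
  IsArtinianRing.of_finite ℂ (NDPFAlg n)

section Classification

variable {n : ℕ} [NeZero n] {M : Type*} [AddCommGroup M] [Module (NDPFAlg n) M]

/-- The full set acts as the identity, so a minimal `S` with nonzero action exists; w is any nonzero
value of that action. -/
theorem exists_minimal_retract_smul_ne_zero [Nontrivial M] :
    ∃ S : Finset (Fin n), 0 ∈ S ∧ ∃ w : M, w ≠ 0 ∧ of ℂ (NDPF n) (NDPF.retract S) • w = w ∧
      ∀ b ∈ S, b ≠ 0 → of ℂ (NDPF n) (NDPF.retract (S.erase b)) • w = 0 := by
  obtain ⟨v, hv⟩ := exists_ne (0 : M)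
  let p : Finset (Fin n) → Prop := fun S =>
    0 ∈ S ∧ ∃ v : M, of ℂ (NDPF n) (NDPF.retract S) • v ≠ 0
  have hp : p Finset.univ := ⟨Finset.mem_univ _, v, by
    rwa [NDPF.retract_univ, map_one, one_smul]⟩
  obtain ⟨S, -, hS⟩ := exists_minimal_le_of_wellFoundedLT p Finset.univ hp
  obtain ⟨h0, v, hv⟩ := hS.prop
  refine ⟨S, h0, _, hv, ?_, fun b hb hb0 => ?_⟩
  · rw [smul_smul, ← map_mul, NDPF.retract_mul_retract_of_subset subset_rfl]
  · by_contra h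
    exact hS.not_prop_of_lt (Finset.erase_ssubset hb) ⟨Finset.mem_erase.2 ⟨hb0.symm, h0⟩, _, h⟩

theorem exists_nonempty_linearEquiv_wedgeSpan (hM : IsIndecomposableModule (NDPFAlg n) M)
    [Module.Projective (NDPFAlg n) M] :
    ∃ S : Finset (Fin n), 0 ∈ S ∧ ∀ (m : ℕ) (t : Fin m → Fin n), StrictMono t →
      Finset.univ.image t = S → Nonempty (M ≃ₗ[NDPFAlg n] wedgeSpan t) := by
  obtain ⟨N, hN⟩ := IsSemiprimaryRing.exists_isCoatom (NDPFAlg n) M hM.1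
  have : Nontrivial (M ⧸ N) := Submodule.Quotient.nontrivial_iff.2 hN.1
  have : IsSimpleModule (NDPFAlg n) (M ⧸ N) := isSimpleModule_iff_isCoatom.2 hN
  obtain ⟨S, h0, w, hw0, hw, hS⟩ := exists_minimal_retract_smul_ne_zero (n := n) (M := M ⧸ N)
  refine ⟨S, h0, ?_⟩
  rintro m t ht rfl
  obtain ⟨ψ, hψ⟩ := exists_linearMap_wedgeSpan ht h0 hw hS
  have := wedgeSpan_projective ht h0
  have := (wedgeSpan_indecomposable ht h0).1
  have hψ0 : ψ ≠ 0 := by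
    rintro rfl
    exact hw0 hψ.symm
  obtain ⟨θ, hθ⟩ := Module.projective_lifting_property ψ N.mkQ
    (LinearMap.surjective_of_ne_zero hψ0)
  obtain ⟨x, hx⟩ := N.mkQ_surjective w
  have hx' : ψ (θ x) = w := (LinearMap.congr_fun hθ x).trans hx
  refine ⟨LinearEquiv.ofBijective θ (hM.bijective_of_surjective
    (LinearMap.range_eq_top.1 (eq_top_of_wedgeCoord_ne_zero ht h0 ⟨x, rfl⟩ fun hc => hψ0 ?_)))⟩
  -- If θ x had coefficient 0, then t - θ x would be an element of ker ψ with coefficient 1, forcing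
  -- ψ = 0.
  refine LinearMap.ker_eq_top.1 (eq_top_of_wedgeCoord_ne_zero ht h0
    (x := ⟨basisWedge t, basisWedge_mem t⟩ - θ x) ?_ ?_)
  · rw [LinearMap.mem_ker, map_sub, hψ, hx', sub_self]
  · rw [Submodule.coe_sub, map_sub, hc, sub_zero]
    exact wedgeCoord_generator ht

end Classification

/-! ### Compositions as subsets containing `0`. -/

section Composition

variable {n : ℕ}

theorem pos_of_mem_descents {I : Composition n} {s : ℕ} (hs : s ∈ descents I) : 0 < s := by
  obtain ⟨j, hj, rfl⟩ := Finset.mem_image.1 hs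
  obtain ⟨h1, h2⟩ := Finset.mem_Ico.1 hj
  have h := I.sizeUpTo_strict_mono (i := j - 1) (by lia)
  rw [Nat.sub_add_cancel h1] at h
  exact (Nat.zero_le _).trans_lt h

variable [NeZero n]

theorem strictMono_cons_descentIndex (I : Composition n) :
    StrictMono (Fin.cons 0 (descentIndex I) : Fin ((descents I).card + 1) → Fin n) := by
  intro i j hij
  obtain ⟨j, rfl⟩ := Fin.exists_succ_eq.2 ((Fin.zero_le i).trans_lt hij).ne'
  rw [Fin.cons_succ]
  refine Fin.cases (fun _ => ?_) (fun i hij => ?_) i hij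
  · rw [Fin.cons_zero, Fin.lt_def]
    exact pos_of_mem_descents ((descents I).orderEmbOfFin_mem rfl j)
  · rw [Fin.cons_succ]
    exact ((descents I).orderEmbOfFin rfl).strictMono (Fin.succ_lt_succ_iff.1 hij)

theorem zero_mem_image_cons_descentIndex (I : Composition n) :
    0 ∈ Finset.univ.image (Fin.cons 0 (descentIndex I) : Fin ((descents I).card + 1) → Fin n) :=
  Finset.mem_image.2 ⟨0, Finset.mem_univ _, Fin.cons_zero _ _⟩

/-- The leading `0` supplies the first boundary; the last boundary n is excluded because it is not a
`castSucc`. -/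
theorem mem_image_cons_descentIndex {I : Composition n} {x : Fin n} :
    x ∈ Finset.univ.image
      (Fin.cons 0 (descentIndex I) : Fin ((descents I).card + 1) → Fin n) ↔
      x.castSucc ∈ I.boundaries := by
  have h1 : (∃ j, descentIndex I j = x) ↔ (x : ℕ) ∈ descents I := by
    constructor
    · rintro ⟨j, rfl⟩
      exact (descents I).orderEmbOfFin_mem rfl j
    · intro h
      rw [← Finset.mem_coe, ← (descents I).range_orderEmbOfFin rfl] at h
      obtain ⟨j, hj⟩ := h
      exact ⟨j, Fin.ext hj⟩
  have h2 : x.castSucc ∈ I.boundaries ↔ ∃ i ≤ I.length, I.sizeUpTo i = x := by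
    simp only [Composition.boundaries, Finset.mem_map, Finset.mem_univ, true_and, Fin.ext_iff]
    constructor
    · rintro ⟨i, hi⟩
      exact ⟨i, Nat.lt_succ_iff.1 i.2, hi⟩
    · rintro ⟨i, hi, h⟩
      exact ⟨⟨i, Nat.lt_succ_iff.2 hi⟩, h⟩
  rw [h2, Finset.mem_image]
  simp only [Finset.mem_univ, true_and, Fin.exists_fin_succ, Fin.cons_zero, Fin.cons_succ, h1]
  constructor
  · rintro (rfl | h)
    · exact ⟨0, Nat.zero_le _, I.sizeUpTo_zero⟩
    · obtain ⟨j, hj, h⟩ := Finset.mem_image.1 h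
      exact ⟨j, (Finset.mem_Ico.1 hj).2.le, h⟩
  · rintro ⟨i, hi, h⟩
    rcases Nat.eq_zero_or_pos i with rfl | hi0
    · exact Or.inl (Fin.ext (by rw [← h, I.sizeUpTo_zero]; rfl))
    · refine Or.inr (Finset.mem_image.2 ⟨i, Finset.mem_Ico.2 ⟨hi0, lt_of_le_of_ne hi ?_⟩, h⟩)
      rintro rfl
      rw [I.sizeUpTo_length] at h
      exact x.2.ne h.symm

theorem Composition.eq_of_image_cons_descentIndex_eq {I J : Composition n}
    (h : Finset.univ.image
        (Fin.cons 0 (descentIndex I) : Fin ((descents I).card + 1) → Fin n) =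
      Finset.univ.image
        (Fin.cons 0 (descentIndex J) : Fin ((descents J).card + 1) → Fin n)) : I = J := by
  refine (compositionEquiv n).injective (CompositionAsSet.ext (Finset.ext fun x => ?_))
  change x ∈ I.boundaries ↔ x ∈ J.boundaries
  refine Fin.lastCases ?_ (fun x => ?_) x
  · exact iff_of_true I.toCompositionAsSet.getLast_mem J.toCompositionAsSet.getLast_mem
  · rw [← mem_image_cons_descentIndex, h, mem_image_cons_descentIndex]

theorem Composition.exists_image_cons_descentIndex_eq {S : Finset (Fin n)} (h0 : 0 ∈ S) :
    ∃ I : Composition n, Finset.univ.image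
      (Fin.cons 0 (descentIndex I) : Fin ((descents I).card + 1) → Fin n) = S := by
  let c : CompositionAsSet n :=
    { boundaries := insert (Fin.last n) (S.map Fin.castSuccEmb)
      zero_mem := Finset.mem_insert_of_mem (Finset.mem_map.2 ⟨0, h0, rfl⟩)
      getLast_mem := Finset.mem_insert_self _ _ }
  refine ⟨c.toComposition, Finset.ext fun x => ?_⟩
  rw [mem_image_cons_descentIndex, c.toComposition_boundaries]
  simp [c, (Fin.castSucc_lt_last x).ne]

end Composition

theorem theorem5p1 (n : ℕ) [NeZero n] :
    -- each `P_I` is an indecomposable projective module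
    (∀ I : Composition n,
      IsIndecomposableModule (NDPFAlg n) (principalSubmodule I) ∧
      Module.Projective (NDPFAlg n) (principalSubmodule I)) ∧
    -- distinct compositions give non-isomorphic modules
    (∀ I J : Composition n,
      Nonempty (principalSubmodule I ≃ₗ[NDPFAlg n] principalSubmodule J) → I = J) ∧
    -- every indecomposable projective module is isomorphic to some `P_I`
    (∀ (M : Type*) [AddCommGroup M] [Module (NDPFAlg n) M],
      IsIndecomposableModule (NDPFAlg n) M → Module.Projective (NDPFAlg n) M →
      ∃ I : Composition n, Nonempty (M ≃ₗ[NDPFAlg n] principalSubmodule I)) := by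
  refine ⟨fun I => ⟨?_, ?_⟩, ?_, ?_⟩
  · exact wedgeSpan_indecomposable (strictMono_cons_descentIndex I)
      (zero_mem_image_cons_descentIndex I)
  · exact wedgeSpan_projective (strictMono_cons_descentIndex I)
      (zero_mem_image_cons_descentIndex I)
  · rintro I J ⟨φ⟩
    exact Composition.eq_of_image_cons_descentIndex_eq (Finset.Subset.antisymm
      (image_subset_of_linearEquiv (strictMono_cons_descentIndex I)
        (zero_mem_image_cons_descentIndex J) φ.symm)
      (image_subset_of_linearEquiv (strictMono_cons_descentIndex J)
        (zero_mem_image_cons_descentIndex I) φ))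
  · intro M _ _ hM _
    obtain ⟨S, h0, hS⟩ := exists_nonempty_linearEquiv_wedgeSpan hM
    obtain ⟨I, hI⟩ := Composition.exists_image_cons_descentIndex_eq h0
    exact ⟨I, hS _ _ (strictMono_cons_descentIndex I) hI⟩
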